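/- A GPT system is a triple $(V,V^+,\mathbb 1)$ where $V$ is a finite-dimensional real vector space, $V^+\subseteq V$ is a closed convex cone with $V^+\cap(-V^+)=\{0\}$ and $V=V^+-V^+$, and $\mathbb 1\in V^*$ is an order unit of $V^*$ for the order given by the dual cone. Its state space is the compact convex set $K=\{\rho\in V^+:\langle \mathbb 1,\rho\rangle=1\}$; an effect is an $f\in V^*$ with $0\le f\le\mathbb 1$; a $k$-outcome measurement is a $k$-tuple $f=(f_1,\dots,f_k)$ of effects with $\sum_a f_a=\mathbb 1$. A boundary measure on $K$ is a Borel probability measure concentrated on the set of extreme points of $K$; its barycenter is $\int_K\rho\,d\mu(\rho)$. Let $(V_A,V_A^+,\mathbb 1_A)$ and $(V_B,V_B^+,\mathbb 1_B)$ be GPT systems and let $\sigma_{AB}\in K_A\otimes_{\max}K_B$, i.e. $\sigma_{AB}\in V_A\otimes V_B$ with $\langle \mathbb 1_A\otimes\mathbb 1_B,\sigma_{AB}\rangle=1$ and $\langle f_A\otimes f_B,\sigma_{AB}\rangle\ge 0$ for all effects $f_A$ on $A$ and $f_B$ on $B$. Put $S_{A\to B}(f)=(f\otimes \mathrm{id}_B)(\sigma_{AB})\in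 V_B$ for $f\in V_A^*$, and $\sigma_B=S_{A\to B}(\mathbb 1_A)$. Let $\mathcal F$ be a set of $k$-outcome measurements on $A$. The state $\sigma_{AB}$ is called $\mathcal F$-unsteerable if for every finite collection $f_{\cdot|1},\dots,f_{\cdot|g}$ of measurements in $\mathcal F$ the conditional states admit a local hidden state model, i.e. there are a finite set $\Lambda$, a probability distribution $q$ on $\Lambda$, conditional probabilities $q(a|x,\lambda)\ge 0$ with $\sum_a q(a|x,\lambda)=1$, and states $\rho_\lambda\in K_B$ such that $$S_{A\to B}(f_{a|x})=\sum_{\lambda\in\Lambda}q(\lambda)\,q(a|x,\lambda)\,\rho_\lambda\qquad\text{for all } a=1,\dots,k,\ x=1,\dots,g.$$ Theorem. The state $\sigma_{AB}$ is $\mathcal F$-unsteerable if and only if there exists a boundary measure $\mu$ on $K_B$ with barycenter $\sigma_B$ such that for all $f\in\mathcal F$ and all $g_1,\dots,g_k\in V_B^*$ (equivalently, affine functions on $K_B$, extended linearly to $V_B$), $$\sum_{a=1}^k\langle g_a,S_{A\to B}(f_a)\rangle\le\int_{K_B}\max_{1\le a\le k}\langle g_a,\rho\rangle\,d\mu(\rho).$$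 -/

import Mathlib

open MeasureTheory TensorProduct

/-- A system `(V, V⁺, 𝟙)` of a general probabilistic theory on a finite-dimensional real vector
space `V`: a closed convex cone `V⁺`, pointed and generating, and an order unit `𝟙` of the dual
space `V*` ordered by the dual cone. The norm of `V` only serves to provide its (unique Hausdorff
vector space) topology. -/
structure GPTSystem (V : Type*) [NormedAddCommGroup V] [NormedSpace ℝ V]
    [FiniteDimensional ℝ V] where
  /-- the positive cone `V⁺`; a `ProperCone` is a closed convex cone containing `0` -/
  cone : ProperCone ℝ V
  /-- `V⁺ ∩ (-V⁺) = {0}` -/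
  pointed : ∀ v : V, v ∈ cone → -v ∈ cone → v = 0
  /-- `V = V⁺ - V⁺` -/
  generating : ∀ v : V, ∃ p ∈ cone, ∃ m ∈ cone, v = p - m
  /-- the unit functional `𝟙` -/
  unit : Module.Dual ℝ V
  /-- for every `f ∈ V*` there is `α > 0` with `α 𝟙 ± f` in the dual cone -/
  orderUnit : ∀ f : Module.Dual ℝ V, ∃ α : ℝ, 0 < α ∧
    (∀ v ∈ cone, 0 ≤ (α • unit + f) v) ∧ (∀ v ∈ cone, 0 ≤ (α • unit - f) v)

namespace GPTSystem

section Single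

variable {V : Type*} [NormedAddCommGroup V] [NormedSpace ℝ V] [FiniteDimensional ℝ V]

/-- The state space `K = {ρ ∈ V⁺ : ⟨𝟙, ρ⟩ = 1}`. -/
def stateSpace (S : GPTSystem V) : Set V :=
  {ρ | ρ ∈ S.cone ∧ S.unit ρ = 1}

/-- The effects: functionals `f` with `0 ≤ f ≤ 𝟙` in the order of the dual cone. -/
def effects (S : GPTSystem V) : Set (Module.Dual ℝ V) :=
  {f | ∀ v ∈ S.cone, 0 ≤ f v ∧ f v ≤ S.unit v}

/-- A measurement with `k` outcomes: effects `f_1, …, f_k` with `∑ a, f_a = 𝟙`. -/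
structure Measurement (S : GPTSystem V) (k : ℕ) where
  effect : Fin k → Module.Dual ℝ V
  effect_mem : ∀ a, effect a ∈ S.effects
  sum_effect : ∑ a, effect a = S.unit

/-- A finite family `ρ_{a|x}` of shape `(k_1, …, k_g)` admits a local hidden state model: there are
a finite set `Λ` (of `n` elements), a probability `q` on `Λ`, conditional probabilities
`p(a|x,l)` and states `τ_l ∈ K` with `ρ_{a|x} = ∑ l, q(l) p(a|x,l) τ_l`. -/
def AdmitsLHS (S : GPTSystem V) {g : ℕ} {k : Fin g → ℕ}
    (ρ : (x : Fin g) → Fin (k x) → V) : Prop :=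
  ∃ (n : ℕ) (q : Fin n → ℝ) (p : (x : Fin g) → Fin (k x) → Fin n → ℝ) (τ : Fin n → V),
    (∀ l, 0 ≤ q l) ∧ (∑ l, q l = 1) ∧
    (∀ x a l, 0 ≤ p x a l) ∧ (∀ x l, ∑ a, p x a l = 1) ∧
    (∀ l, τ l ∈ S.stateSpace) ∧
    ∀ x a, ρ x a = ∑ l, (q l * p x a l) • τ l

/-- The boundary measures with barycenter `σ`: Borel probability measures on the state space `K`
that are concentrated on the extreme points of `K` and satisfy `∫ ρ dμ(ρ) = σ`. (On the compact
metrizable space `K`, Borel probability measures are Radon.) -/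
def boundaryMeasures [MeasurableSpace V] [BorelSpace V] (S : GPTSystem V) (σ : V) :
    Set (ProbabilityMeasure S.stateSpace) :=
  {μ | (μ : Measure S.stateSpace) {ρ | (ρ : V) ∉ S.stateSpace.extremePoints ℝ} = 0 ∧
    ∫ ρ, (ρ : V) ∂(μ : Measure S.stateSpace) = σ}

end Single

section Bipartite

variable {VA VB : Type*}
  [NormedAddCommGroup VA] [NormedSpace ℝ VA] [FiniteDimensional ℝ VA]
  [NormedAddCommGroup VB] [NormedSpace ℝ VB] [FiniteDimensional ℝ VB]

/-- The maximal bipartite state space: `σ ∈ V_A ⊗ V_B` with `⟨f_A ⊗ f_B, σ⟩ ≥ 0` for all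
effects `f_A`, `f_B`, and `⟨𝟙_A ⊗ 𝟙_B, σ⟩ = 1`. -/
def maxStateSpace (A : GPTSystem VA) (B : GPTSystem VB) : Set (VA ⊗[ℝ] VB) :=
  {σ | (∀ fA ∈ A.effects, ∀ fB ∈ B.effects,
      0 ≤ TensorProduct.dualDistrib ℝ VA VB (fA ⊗ₜ[ℝ] fB) σ) ∧
    TensorProduct.dualDistrib ℝ VA VB (A.unit ⊗ₜ[ℝ] B.unit) σ = 1}

/-- The map `S_{A→B} : V_A* → V_B` given by a bipartite element `σ`:
`S_{A→B}(f) = (f ⊗ id_B)(σ)`. -/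
def steeringMap (σ : VA ⊗[ℝ] VB) (f : Module.Dual ℝ VA) : VB :=
  TensorProduct.lid ℝ VB (LinearMap.rTensor VB f σ)

/-- The defining duality `⟨h, S_{A→B}(f)⟩ = ⟨f ⊗ h, σ⟩`. -/
theorem apply_steeringMap (σ : VA ⊗[ℝ] VB) (f : Module.Dual ℝ VA) (h : Module.Dual ℝ VB) :
    h (steeringMap σ f) = TensorProduct.dualDistrib ℝ VA VB (f ⊗ₜ[ℝ] h) σ := by
  unfold steeringMap
  induction σ with
  | zero => simp
  | tmul a b => simp
  | add s t hs ht => simp only [map_add, hs, ht]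

/-- `σ` is unsteerable (from `A` to `B`) by the set `F` of `k`-outcome measurements on `A`: for all
finite collections of measurements in `F`, the assemblage of conditional states
`ρ_{a|x} = (f_{a|x} ⊗ id_B)(σ)` admits a local hidden state model. -/
def Unsteerable (A : GPTSystem VA) (B : GPTSystem VB) {k : ℕ} (F : Set (A.Measurement k))
    (σ : VA ⊗[ℝ] VB) : Prop :=
  ∀ (g : ℕ) (f : Fin g → A.Measurement k), (∀ x, f x ∈ F) →
    B.AdmitsLHS (k := fun _ => k) fun x a => steeringMap σ ((f x).effect a)

end Bipartite

end GPTSystem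

/-! A hidden state model is a finitely supported measure on `K_B`, and averaging `⟨g_a, ·⟩` over a
response never exceeds the maximum over `a`; so a model yields the inequality for each measurement
it serves. For one measurement these inequalities cut out a weakly closed set of probability
measures. Since these measures form a compact space, the finite intersection property gives one
measure for all of `F` (`Unsteerable.exists_mem_steeringMeasures`). Maxima of linear functionals are
convex, so the measure may be replaced by one on the extreme points that dominates it in convex
order (`exists_extremal_dominating`); linear functionals fix the barycenter.

Conversely, sum the inequalities over a finite collection: some state does at least as well as the
average. Hence no functional separates the assemblage from the compact convex set of assemblages
produced by deterministic strategies, and Hahn–Banach gives a model (`admitsLHS_of_forall_dual`). -/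

/-! ### Convex order and measures on extreme points -/

section ConvexOrder

open Filter Topology

variable {E : Type*} [NormedAddCommGroup E] [NormedSpace ℝ E] [FiniteDimensional ℝ E]

/-- The sum of the squares of the coordinates, a positive definite quadratic form. -/
noncomputable def coordSq (v : E) : ℝ := ∑ i, ((Module.finBasis ℝ E).coord i v) ^ 2

theorem continuous_coordSq : Continuous (coordSq : E → ℝ) := by
  unfold coordSq
  refine continuous_finsetSum _ fun i _ => ?_
  exact ((Module.finBasis ℝ E).coord i).continuous_of_finiteDimensional.pow 2

theorem coordSq_nonneg (v : E) : 0 ≤ coordSq v :=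
  Finset.sum_nonneg fun _ _ => sq_nonneg _

theorem coordSq_pos {v : E} (hv : v ≠ 0) : 0 < coordSq v := by
  refine lt_of_le_of_ne (coordSq_nonneg v) fun h => hv ?_
  have h' := (Finset.sum_eq_zero_iff_of_nonneg (fun i _ => sq_nonneg _)).1 h.symm
  refine (Module.finBasis ℝ E).ext_elem fun i => ?_
  simpa using h' i (Finset.mem_univ i)

/-- Parallelogram law: it measures the strict convexity of `coordSq`. -/
theorem coordSq_midpoint (x y : E) :
    coordSq ((1 / 2 : ℝ) • x + (1 / 2 : ℝ) • y) + 1 / 4 * coordSq (x - y) =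
      1 / 2 * coordSq x + 1 / 2 * coordSq y := by
  simp only [coordSq, Finset.mul_sum, ← Finset.sum_add_distrib, map_add, map_sub, map_smul,
    smul_eq_mul]
  exact Finset.sum_congr rfl fun i _ => by ring

omit [FiniteDimensional ℝ E] in
theorem exists_midpoint_of_notMem_extremePoints {K : Set E} (hK : Convex ℝ K) {e : E}
    (he : e ∈ K) (hne : e ∉ K.extremePoints ℝ) :
    ∃ x ∈ K, ∃ y ∈ K, x ≠ y ∧ e = (1 / 2 : ℝ) • x + (1 / 2 : ℝ) • y := by
  have key : ∀ x ∈ K, ∀ y ∈ K, ∀ a b : ℝ, 0 < a → a ≤ b → a + b = 1 → x ≠ y →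
      ∃ x' ∈ K, ∃ y' ∈ K, x' ≠ y' ∧ a • x + b • y = (1 / 2 : ℝ) • x' + (1 / 2 : ℝ) • y' := by
    intro x hx y hy a b ha hab h1 hxy
    -- The reflection of `y` through the point; it stays on the segment because `a ≤ 1/2`.
    refine ⟨(2 * a) • x + (1 - 2 * a) • y, hK hx hy (by linarith) (by linarith) (by ring), y, hy,
      ?_, ?_⟩
    · intro h
      have h2 : (2 * a) • (x - y) = 0 := by
        rw [← sub_eq_zero] at h
        rw [← h]
        module
      rcases smul_eq_zero.1 h2 with h3 | h3
      · linarith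
      · exact hxy (sub_eq_zero.1 h3)
    · obtain rfl : b = 1 - a := by linarith
      module
  rw [mem_extremePoints] at hne
  push Not at hne
  obtain ⟨x, hx, y, hy, hxy, hxe⟩ := hne he
  obtain ⟨a, b, ha, hb, h1, rfl⟩ := hxy
  have hne : x ≠ y := by
    rintro rfl
    have : a • x + b • x = x := by rw [← add_smul, h1, one_smul]
    exact hxe this.symm this.symm
  rcases le_total a b with h | h
  · exact key x hx y hy a b ha h h1 hne
  · rw [add_comm (a • x)]
    exact key y hy x hx b a hb h (by linarith) hne.symm

/-- The points of `K` that are midpoints of two points of `K` at squared distance at least `δ`. -/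
def farMidpoints (K : Set E) (δ : ℝ) : Set K :=
  {e | ∃ x y : K, (e : E) = (1 / 2 : ℝ) • (x : E) + (1 / 2 : ℝ) • (y : E) ∧
    δ ≤ coordSq ((x : E) - y)}

/-- The set is the projection of a closed subset of the compact `K × K × K`; the threshold `δ` is
what keeps the condition closed. -/
theorem isClosed_farMidpoints {K : Set E} (hK : IsCompact K) (δ : ℝ) :
    IsClosed (farMidpoints K δ) := by
  have : CompactSpace K := isCompact_iff_compactSpace.1 hK
  have hc : IsClosed {p : K × K × K | (p.1 : E) = (1 / 2 : ℝ) • (p.2.1 : E) +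
      (1 / 2 : ℝ) • (p.2.2 : E) ∧ δ ≤ coordSq ((p.2.1 : E) - p.2.2)} := by
    have hq : Continuous fun p : K × K × K => coordSq ((p.2.1 : E) - p.2.2) :=
      continuous_coordSq.comp (by fun_prop)
    exact (isClosed_eq (by fun_prop) (by fun_prop)).inter (isClosed_le continuous_const hq)
  convert (hc.isCompact.image continuous_fst).isClosed using 1
  ext e
  simp [farMidpoints]

variable [MeasurableSpace E] [BorelSpace E]

omit [NormedSpace ℝ E] [FiniteDimensional ℝ E] in
theorem integrable_of_measurable_of_continuous {K : Set E} (hK : IsCompact K)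
    (μ : ProbabilityMeasure K) {φ : E → ℝ} (hφ : Continuous φ) {s : K → K} (hs : Measurable s) :
    Integrable (fun x => φ (s x)) (μ : Measure K) := by
  obtain ⟨C, hC⟩ := hK.exists_bound_of_continuousOn hφ.continuousOn
  refine Integrable.of_bound ?_ C (Eventually.of_forall fun x => hC _ (s x).2)
  exact ((hφ.comp continuous_subtype_val).measurable.comp hs).aestronglyMeasurable

omit [NormedSpace ℝ E] [FiniteDimensional ℝ E] in
theorem continuous_integral_probabilityMeasure {K : Set E} (hK : IsCompact K) {φ : E → ℝ}
    (hφ : Continuous φ) :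
    Continuous fun μ : ProbabilityMeasure K => ∫ x, φ x ∂(μ : Measure K) := by
  have : CompactSpace K := isCompact_iff_compactSpace.1 hK
  exact ProbabilityMeasure.continuous_integral_boundedContinuousFunction
    (BoundedContinuousFunction.mkOfCompact ⟨fun x : K => φ x, by fun_prop⟩)

/-- Mass on midpoints can be approximately spread to the end points. -/
theorem exists_tendsto_spread {K : Set E} (hK : IsCompact K)
    (μ : ProbabilityMeasure K) (δ : ℝ) :
    ∃ (ν : ℕ → ProbabilityMeasure K) (t : ℕ → K → K), (∀ n, Measurable (t n)) ∧
      (∀ x, Tendsto (fun n => t n x) atTop (𝓝 x)) ∧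
      ∀ (φ : E → ℝ) (c : ℝ), 0 ≤ c → Continuous φ →
        (∀ x ∈ K, ∀ y ∈ K, φ ((1 / 2 : ℝ) • x + (1 / 2 : ℝ) • y) + c * coordSq (x - y) ≤
          1 / 2 * φ x + 1 / 2 * φ y) →
        ∀ n, ∫ x, φ (t n x) ∂(μ : Measure K) + c * δ * (μ : Measure K).real (farMidpoints K δ) ≤
          ∫ x, φ x ∂(ν n : Measure K) := by
  classical
  set M := farMidpoints K δ with hM
  rcases M.eq_empty_or_nonempty with hemp | ⟨y₀, hy₀⟩
  · exact ⟨fun _ => μ, fun _ => id, fun _ => measurable_id, fun x => tendsto_const_nhds,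
      fun φ c hc _ _ n => by simp [hemp]⟩
  have hMm : MeasurableSet M := (isClosed_farMidpoints hK δ).measurableSet
  have hch : ∀ e : K, ∃ p : K × K, e ∈ M →
      (e : E) = (1 / 2 : ℝ) • (p.1 : E) + (1 / 2 : ℝ) • (p.2 : E) ∧
        δ ≤ coordSq ((p.1 : E) - p.2) := by
    intro e
    by_cases he : e ∈ M
    · obtain ⟨x, y, h⟩ := he
      exact ⟨(x, y), fun _ => h⟩
    · exact ⟨(e, e), fun h => absurd h he⟩
  choose p hp using hch
  -- The choice `p` of end points need not be measurable. Composed with simple functions that take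
  -- values in `M` and approximate the identity there, it becomes measurable.
  let r : ℕ → SimpleFunc K K := fun n => SimpleFunc.approxOn id measurable_id M y₀ hy₀ n
  have hr : ∀ n x, r n x ∈ M := fun n x => SimpleFunc.approxOn_mem measurable_id hy₀ n x
  let s₁ : ℕ → K → K := fun n => M.piecewise ((r n).map fun e => (p e).1) id
  let s₂ : ℕ → K → K := fun n => M.piecewise ((r n).map fun e => (p e).2) id
  let t : ℕ → K → K := fun n => M.piecewise (r n) id
  have hs₁ : ∀ n, Measurable (s₁ n) := fun n =>
    Measurable.piecewise hMm (SimpleFunc.measurable _) measurable_id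
  have hs₂ : ∀ n, Measurable (s₂ n) := fun n =>
    Measurable.piecewise hMm (SimpleFunc.measurable _) measurable_id
  have ht : ∀ n, Measurable (t n) := fun n =>
    Measurable.piecewise hMm (SimpleFunc.measurable _) measurable_id
  have hprob : ∀ n, IsProbabilityMeasure ((1 / 2 : ENNReal) • (μ : Measure K).map (s₁ n) +
      (1 / 2 : ENNReal) • (μ : Measure K).map (s₂ n)) := by
    intro n
    constructor
    simp only [Measure.add_apply, Measure.smul_apply, smul_eq_mul]
    rw [Measure.map_apply (hs₁ n) MeasurableSet.univ, Measure.map_apply (hs₂ n) MeasurableSet.univ]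
    simp [ENNReal.inv_two_add_inv_two]
  refine ⟨fun n => ⟨_, hprob n⟩, t, ht, ?_, ?_⟩
  · intro x
    by_cases hx : x ∈ M
    · have := SimpleFunc.tendsto_approxOn (f := (id : K → K)) measurable_id hy₀
        (x := x) (subset_closure hx)
      simpa [t, hx, r] using this
    · simp [t, hx]
  · intro φ c hc hφ hconv n
    have hφm : ∀ ν : Measure K, AEStronglyMeasurable (fun x : K => φ x) ν := fun ν =>
      (hφ.comp continuous_subtype_val).aestronglyMeasurable
    have i₁ := integrable_of_measurable_of_continuous hK μ hφ (hs₁ n)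
    have i₂ := integrable_of_measurable_of_continuous hK μ hφ (hs₂ n)
    have it := integrable_of_measurable_of_continuous hK μ hφ (ht n)
    have e₁ : Integrable (fun x : K => φ x) ((μ : Measure K).map (s₁ n)) :=
      (integrable_map_measure (hφm _) (hs₁ n).aemeasurable).2 i₁
    have e₂ : Integrable (fun x : K => φ x) ((μ : Measure K).map (s₂ n)) :=
      (integrable_map_measure (hφm _) (hs₂ n).aemeasurable).2 i₂
    have hint : ∫ x, φ x ∂((1 / 2 : ENNReal) • (μ : Measure K).map (s₁ n) +
        (1 / 2 : ENNReal) • (μ : Measure K).map (s₂ n)) =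
        ∫ x, (1 / 2 * φ (s₁ n x) + 1 / 2 * φ (s₂ n x)) ∂(μ : Measure K) := by
      rw [integral_add_measure (e₁.smul_measure (by simp)) (e₂.smul_measure (by simp)),
        integral_smul_measure, integral_smul_measure,
        integral_map (hs₁ n).aemeasurable (hφm _), integral_map (hs₂ n).aemeasurable (hφm _),
        integral_add (i₁.const_mul _) (i₂.const_mul _), integral_const_mul, integral_const_mul]
      simp
    have hind : Integrable (M.indicator fun _ => c * δ) (μ : Measure K) :=
      (integrable_const _).indicator hMm
    calc _ = ∫ x, (φ (t n x) + M.indicator (fun _ => c * δ) x) ∂(μ : Measure K) := by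
          rw [integral_add it hind, integral_indicator_const _ hMm, smul_eq_mul, mul_comm (c * δ)]
      _ ≤ ∫ x, (1 / 2 * φ (s₁ n x) + 1 / 2 * φ (s₂ n x)) ∂(μ : Measure K) := by
          refine integral_mono (it.add hind) ((i₁.const_mul _).add (i₂.const_mul _)) fun x => ?_
          by_cases hx : x ∈ M
          · have h1 := hp _ (hr n x)
            have h2 := hconv _ (p (r n x)).1.2 _ (p (r n x)).2.2
            rw [← h1.1] at h2
            have h3 := mul_le_mul_of_nonneg_left h1.2 hc
            simp only [t, s₁, s₂, hx, Set.piecewise_eq_of_mem, Set.indicator_of_mem,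
              SimpleFunc.map_apply]
            linarith
          · simp only [t, s₁, s₂, hx, Set.piecewise_eq_of_notMem, Set.indicator_of_notMem,
              not_false_eq_true, id]
            linarith
      _ = _ := hint.symm

/-- A weak cluster point of the approximate spreads works: the right side converges along an
ultrafilter, the left side by dominated convergence. -/
theorem exists_spread {K : Set E} (hK : IsCompact K) (μ : ProbabilityMeasure K) (δ : ℝ) :
    ∃ ν : ProbabilityMeasure K, ∀ (φ : E → ℝ) (c : ℝ), 0 ≤ c → Continuous φ →
      (∀ x ∈ K, ∀ y ∈ K, φ ((1 / 2 : ℝ) • x + (1 / 2 : ℝ) • y) + c * coordSq (x - y) ≤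
        1 / 2 * φ x + 1 / 2 * φ y) →
      ∫ x, φ x ∂(μ : Measure K) + c * δ * (μ : Measure K).real (farMidpoints K δ) ≤
        ∫ x, φ x ∂(ν : Measure K) := by
  have : CompactSpace K := isCompact_iff_compactSpace.1 hK
  obtain ⟨ν, t, htm, ht, h⟩ := exists_tendsto_spread hK μ δ
  obtain ⟨ν', -, hν'⟩ := isCompact_univ.exists_mapClusterPt (f := (atTop : Filter ℕ)) (u := ν)
    (by simp)
  obtain ⟨U, hU, hlim⟩ := mapClusterPt_iff_ultrafilter.1 hν'
  refine ⟨ν', fun φ c hc hφ hconv => ?_⟩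
  refine le_of_tendsto_of_tendsto (b := (U : Filter ℕ)) ?_
    ((continuous_integral_probabilityMeasure hK hφ).continuousAt.tendsto.comp hlim)
    (Eventually.of_forall (h φ c hc hφ hconv))
  refine Tendsto.mono_left (Tendsto.add_const _ ?_) hU
  obtain ⟨C, hC⟩ := hK.exists_bound_of_continuousOn hφ.continuousOn
  refine tendsto_integral_of_dominated_convergence (fun _ => C) (fun n => ?_)
    (integrable_const C) (fun n => ?_) ?_
  · exact (integrable_of_measurable_of_continuous hK μ hφ (htm n)).aestronglyMeasurable
  · exact Eventually.of_forall fun x => hC _ (t n x).2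
  · exact Eventually.of_forall fun x =>
      ((hφ.comp continuous_subtype_val).tendsto x).comp (ht x)

/-- Every probability measure on a compact convex set of finite dimension is dominated, in the
convex order, by one that is concentrated on the extreme points. -/
theorem exists_extremal_dominating {K : Set E} (hK : IsCompact K) (hKc : Convex ℝ K)
    (μ : ProbabilityMeasure K) :
    ∃ ν : ProbabilityMeasure K,
      (ν : Measure K) {ρ | (ρ : E) ∉ K.extremePoints ℝ} = 0 ∧
      ∀ φ : E → ℝ, Continuous φ → ConvexOn ℝ K φ →
        ∫ x, φ x ∂(μ : Measure K) ≤ ∫ x, φ x ∂(ν : Measure K) := by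
  have : CompactSpace K := isCompact_iff_compactSpace.1 hK
  let D : Set (ProbabilityMeasure K) := {ν | ∀ φ : E → ℝ, Continuous φ → ConvexOn ℝ K φ →
        ∫ x, φ x ∂(μ : Measure K) ≤ ∫ x, φ x ∂(ν : Measure K)}
  have hD : IsClosed D := by
    simp only [D, Set.ofPred_forall]
    exact isClosed_iInter fun φ => isClosed_iInter fun hφ => isClosed_iInter fun _ =>
      isClosed_le continuous_const (continuous_integral_probabilityMeasure hK hφ)
  -- Maximize a strictly convex integral among the dominating measures: spreading mass from far
  -- midpoints stays in `D` (case `c = 0`) and would raise the integral (case `c = 1/4`).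
  obtain ⟨ν, hνD, hmax⟩ := hD.isCompact.exists_isMaxOn ⟨μ, fun _ _ _ => le_rfl⟩
    (continuous_integral_probabilityMeasure hK continuous_coordSq).continuousOn
  refine ⟨ν, ?_, hνD⟩
  have hnull : ∀ δ : ℝ, 0 < δ → (ν : Measure K) (farMidpoints K δ) = 0 := by
    intro δ hδ
    obtain ⟨ν', hν'⟩ := exists_spread hK ν δ
    have hmem : ν' ∈ D := fun φ hφ hconv => by
      refine (hνD φ hφ hconv).trans ?_
      simpa using hν' φ 0 le_rfl hφ fun x hx y hy => by
        simpa using hconv.2 hx hy (by norm_num : (0 : ℝ) ≤ 1 / 2) (by norm_num : (0 : ℝ) ≤ 1 / 2)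
          (by norm_num)
    have h1 := hν' coordSq (1 / 4) (by norm_num) continuous_coordSq
      fun x _ y _ => (coordSq_midpoint x y).le
    have h2 : ∫ x, coordSq (x : E) ∂(ν' : Measure K) ≤ ∫ x, coordSq (x : E) ∂(ν : Measure K) :=
      hmax hmem
    rw [← measureReal_eq_zero_iff]
    have h3 : (0 : ℝ) ≤ (ν : Measure K).real (farMidpoints K δ) := measureReal_nonneg
    nlinarith
  refine measure_mono_null (t := ⋃ n : ℕ, farMidpoints K (1 / ((n : ℝ) + 1))) ?_
    (measure_iUnion_null fun n => hnull _ (by positivity))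
  intro e he
  obtain ⟨x, hx, y, hy, hxy, hm⟩ := exists_midpoint_of_notMem_extremePoints hKc e.2 he
  obtain ⟨n, hn⟩ := exists_nat_one_div_lt (coordSq_pos (sub_ne_zero.2 hxy))
  exact Set.mem_iUnion.2 ⟨n, ⟨x, hx⟩, ⟨y, hy⟩, hm, hn.le⟩

end ConvexOrder

/-! ### Maxima of finitely many functionals -/

section FiniteSup

variable {V : Type*} [NormedAddCommGroup V] [NormedSpace ℝ V] [FiniteDimensional ℝ V]

theorem continuous_iSup_dual {ι : Type*} [Finite ι] (g : ι → Module.Dual ℝ V) :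
    Continuous fun v => ⨆ a, g a v := by
  cases nonempty_fintype ι
  rcases isEmpty_or_nonempty ι with h | h
  · simp only [Real.iSup_of_isEmpty]
    exact continuous_const
  · have hsup : (fun v => ⨆ a, g a v) =
        fun v => Finset.univ.sup' Finset.univ_nonempty fun a => g a v := by
      funext v
      exact (Finset.sup'_univ_eq_ciSup fun a => g a v).symm
    rw [hsup]
    exact Continuous.finset_sup'_apply _ fun a _ => (g a).continuous_of_finiteDimensional

omit [FiniteDimensional ℝ V] in
theorem dual_le_iSup {ι : Type*} [Finite ι] (g : ι → Module.Dual ℝ V) (v : V) (a : ι) :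
    g a v ≤ ⨆ a, g a v :=
  le_ciSup (f := fun a => g a v) (Set.finite_range _).bddAbove a

omit [FiniteDimensional ℝ V] in
theorem convexOn_iSup_dual {ι : Type*} [Finite ι] (g : ι → Module.Dual ℝ V) {K : Set V}
    (hK : Convex ℝ K) : ConvexOn ℝ K fun v => ⨆ a, g a v := by
  refine ⟨hK, fun x _ y _ a b ha hb _ => ?_⟩
  rcases isEmpty_or_nonempty ι with h | h
  · simp
  · refine ciSup_le fun i => ?_
    simp only [map_add, map_smul, smul_eq_mul]
    gcongr <;> exact dual_le_iSup g _ i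

end FiniteSup

/-! ### State spaces and steering inequalities on one system -/

namespace GPTSystem

section Single

variable {V : Type*} [NormedAddCommGroup V] [NormedSpace ℝ V] [FiniteDimensional ℝ V]

theorem mem_cone_of_forall_dual (S : GPTSystem V) {v : V}
    (h : ∀ f : Module.Dual ℝ V, (∀ w ∈ S.cone, 0 ≤ f w) → 0 ≤ f v) : v ∈ S.cone := by
  by_contra hv
  obtain ⟨f, hf, hfv⟩ := S.cone.hyperplane_separation_point hv
  exact absurd (h (f : V →ₗ[ℝ] ℝ) hf) (not_le.2 hfv)

theorem unit_nonneg (S : GPTSystem V) {v : V} (hv : v ∈ S.cone) : 0 ≤ S.unit v := by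
  obtain ⟨α, hα, h1, h2⟩ := S.orderUnit 0
  have := h1 v hv
  simp only [add_zero, LinearMap.smul_apply, smul_eq_mul] at this
  exact nonneg_of_mul_nonneg_right this hα

/-- As a multiple of the unit dominates any functional, positive functionals are `≤ 0` at `v`; by
duality `-v` is in the cone, which is pointed. -/
theorem eq_zero_of_unit_eq_zero (S : GPTSystem V) {v : V} (hv : v ∈ S.cone)
    (h : S.unit v = 0) : v = 0 := by
  refine S.pointed v hv (S.mem_cone_of_forall_dual fun f _ => ?_)
  obtain ⟨α, -, -, h2⟩ := S.orderUnit f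
  simpa [h] using h2 v hv

/-- The order unit bounds each coordinate functional in absolute value. -/
theorem isCompact_subnormalized (S : GPTSystem V) :
    IsCompact {v | v ∈ S.cone ∧ S.unit v ≤ 1} := by
  refine Metric.isCompact_of_isClosed_isBounded ?_ ?_
  · exact S.cone.isClosed.inter
      (isClosed_le S.unit.continuous_of_finiteDimensional continuous_const)
  · let b := Module.finBasis ℝ V
    choose α hα h1 h2 using fun i => S.orderUnit (b.coord i)
    refine isBounded_iff_forall_norm_le.2 ⟨∑ i, α i * ‖b i‖, fun v hv => ?_⟩
    calc ‖v‖ = ‖∑ i, b.repr v i • b i‖ := by rw [b.sum_repr]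
      _ ≤ ∑ i, ‖b.repr v i • b i‖ := norm_sum_le _ _
      _ ≤ ∑ i, α i * ‖b i‖ := by
        refine Finset.sum_le_sum fun i _ => ?_
        rw [norm_smul]
        refine mul_le_mul_of_nonneg_right ?_ (norm_nonneg _)
        have h3 := h1 i v hv.1
        have h4 := h2 i v hv.1
        have h5 := mul_le_mul_of_nonneg_left hv.2 (hα i).le
        simp only [LinearMap.add_apply, LinearMap.sub_apply, LinearMap.smul_apply, smul_eq_mul,
          Module.Basis.coord_apply] at h3 h4
        rw [Real.norm_eq_abs, abs_le]
        constructor <;> linarith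

theorem isCompact_stateSpace (S : GPTSystem V) : IsCompact S.stateSpace := by
  refine S.isCompact_subnormalized.of_isClosed_subset ?_ fun v hv => ⟨hv.1, hv.2.le⟩
  exact S.cone.isClosed.inter
    (isClosed_eq S.unit.continuous_of_finiteDimensional continuous_const)

theorem convex_stateSpace (S : GPTSystem V) : Convex ℝ S.stateSpace := by
  intro x hx y hy a b ha hb hab
  refine ⟨S.cone.toPointedCone.convex hx.1 hy.1 ha hb hab, ?_⟩
  simp [hx.2, hy.2, hab]

/-- Families of subnormalized states, indexed by deterministic strategies, of total weight one. -/
def weightedStates (S : GPTSystem V) (ι : Type*) [Fintype ι] : Set (ι → V) :=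
  {w | (∀ s, w s ∈ S.cone) ∧ ∑ s, S.unit (w s) = 1}

theorem isCompact_weightedStates (S : GPTSystem V) (ι : Type*) [Fintype ι] :
    IsCompact (S.weightedStates ι) := by
  refine (isCompact_univ_pi fun _ : ι => S.isCompact_subnormalized).of_isClosed_subset ?_ ?_
  · have h1 : IsClosed {w : ι → V | ∀ s, w s ∈ S.cone} := by
      simp only [Set.ofPred_forall]
      exact isClosed_iInter fun s => S.cone.isClosed.preimage (continuous_apply s)
    refine h1.inter (isClosed_eq ?_ continuous_const)
    exact continuous_finsetSum _ fun s _ =>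
      S.unit.continuous_of_finiteDimensional.comp (continuous_apply s)
  · intro w hw s _
    refine ⟨hw.1 s, ?_⟩
    rw [← hw.2]
    exact Finset.single_le_sum (f := fun s => S.unit (w s)) (fun t _ => S.unit_nonneg (hw.1 t))
      (Finset.mem_univ s)

theorem convex_weightedStates (S : GPTSystem V) (ι : Type*) [Fintype ι] :
    Convex ℝ (S.weightedStates ι) := by
  intro x hx y hy a b ha hb hab
  refine ⟨fun s => S.cone.toPointedCone.convex (hx.1 s) (hy.1 s) ha hb hab, ?_⟩
  simp [Finset.sum_add_distrib, ← Finset.mul_sum, hx.2, hy.2, hab]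

/-- The assemblage generated by a family of subnormalized states indexed by the deterministic
strategies. -/
def assemblageOfStrategies (V : Type*) [NormedAddCommGroup V] [NormedSpace ℝ V] (g k : ℕ) :
    ((Fin g → Fin k) → V) →ₗ[ℝ] (Fin g → Fin k → V) :=
  LinearMap.pi fun x => LinearMap.pi fun a =>
    ∑ s : Fin g → Fin k, if s x = a then LinearMap.proj s else 0

omit [FiniteDimensional ℝ V] in
theorem assemblageOfStrategies_apply {g k : ℕ} (w : (Fin g → Fin k) → V) (x : Fin g)
    (a : Fin k) :
    assemblageOfStrategies V g k w x a = ∑ s : Fin g → Fin k, if s x = a then w s else 0 := by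
  simp only [assemblageOfStrategies, LinearMap.pi_apply, LinearMap.sum_apply]
  refine Finset.sum_congr rfl fun s _ => ?_
  split_ifs <;> simp

theorem admitsLHS_assemblageOfStrategies (S : GPTSystem V) {g k : ℕ}
    {w : (Fin g → Fin k) → V} (hw : w ∈ S.weightedStates (Fin g → Fin k)) {τ₀ : V}
    (hτ₀ : τ₀ ∈ S.stateSpace) :
    S.AdmitsLHS (k := fun _ => k) (assemblageOfStrategies V g k w) := by
  classical
  let e := (Fintype.equivFin (Fin g → Fin k)).symm
  let τ : (Fin g → Fin k) → V := fun s =>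
    -- Strategies of weight zero get an arbitrary state, as normalization is impossible.
    if S.unit (w s) = 0 then τ₀ else (S.unit (w s))⁻¹ • w s
  have hwτ : ∀ s, w s = S.unit (w s) • τ s := by
    intro s
    by_cases h : S.unit (w s) = 0
    · rw [h, zero_smul]
      exact S.eq_zero_of_unit_eq_zero (hw.1 s) h
    · simp only [τ, h, if_false]
      rw [smul_inv_smul₀ h]
  refine ⟨_, fun l => S.unit (w (e l)), fun x a l => if e l x = a then 1 else 0,
    fun l => τ (e l), fun l => S.unit_nonneg (hw.1 _), ?_, ?_, ?_, ?_, ?_⟩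
  · rw [← hw.2]
    exact e.sum_comp fun s => S.unit (w s)
  · intro x a l
    dsimp only
    split_ifs <;> simp
  · intro x l
    simp
  · intro l
    by_cases h : S.unit (w (e l)) = 0
    · simpa only [τ, h, if_true] using hτ₀
    · simp only [τ, h, if_false]
      refine ⟨S.cone.smul_mem (hw.1 _) (inv_nonneg.2 (S.unit_nonneg (hw.1 _))), ?_⟩
      rw [map_smul, smul_eq_mul, inv_mul_cancel₀ h]
  · intro x a
    rw [assemblageOfStrategies_apply, ← e.sum_comp]
    refine Finset.sum_congr rfl fun l _ => ?_
    by_cases h : e l x = a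
    · simp only [h, if_true, mul_one]
      exact hwτ _
    · simp [h]

/-- An assemblage that satisfies all steering inequalities admits a local hidden state model. -/
theorem admitsLHS_of_forall_dual (S : GPTSystem V) {g k : ℕ} (hk : Fin g → Nonempty (Fin k))
    (ρ : Fin g → Fin k → V)
    (h : ∀ f : Fin g → Fin k → Module.Dual ℝ V, ∃ τ ∈ S.stateSpace,
      ∑ x, ∑ a, f x a (ρ x a) ≤ ∑ x, ⨆ a, f x a τ) :
    S.AdmitsLHS (k := fun _ => k) ρ := by
  classical
  by_cases hmem : ρ ∈ assemblageOfStrategies V g k '' S.weightedStates (Fin g → Fin k)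
  · obtain ⟨w, hw, rfl⟩ := hmem
    -- The zero functionals serve only to provide a state.
    obtain ⟨τ, hτ, -⟩ := h 0
    exact S.admitsLHS_assemblageOfStrategies hw hτ
  exfalso
  obtain ⟨φ, u, hφ, hu⟩ := geometric_hahn_banach_closed_point
    ((S.convex_weightedStates _).linear_image (assemblageOfStrategies V g k))
    ((S.isCompact_weightedStates _).image
      (assemblageOfStrategies V g k).continuous_of_finiteDimensional).isClosed hmem
  let f : Fin g → Fin k → Module.Dual ℝ V := fun x a =>
    (φ : (Fin g → Fin k → V) →ₗ[ℝ] ℝ) ∘ₗ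
      LinearMap.single ℝ (fun _ : Fin g => Fin k → V) x ∘ₗ
      LinearMap.single ℝ (fun _ : Fin k => V) a
  have hdec : ∀ η : Fin g → Fin k → V, φ η = ∑ x, ∑ a, f x a (η x a) := by
    intro η
    conv_lhs => rw [← Finset.univ_sum_single η]
    rw [map_sum]
    refine Finset.sum_congr rfl fun x _ => ?_
    have hx := map_sum ((φ : (Fin g → Fin k → V) →ₗ[ℝ] ℝ) ∘ₗ
      LinearMap.single ℝ (fun _ : Fin g => Fin k → V) x) (fun a => Pi.single a (η x a))
      Finset.univ
    rw [Finset.univ_sum_single (η x)] at hx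
    exact hx
  obtain ⟨τ, hτ, hle⟩ := h f
  have hex : ∀ x, ∃ a, f x a τ = ⨆ a, f x a τ := fun x => by
    have := hk x
    exact exists_eq_ciSup_of_finite (f := fun a => f x a τ)
  choose s hs using hex
  -- All weight goes to the strategy `s` that picks a maximizing outcome at `τ`; its assemblage
  -- attains the right side of `hle`, against strict separation.
  have hw : Pi.single s τ ∈ S.weightedStates (Fin g → Fin k) := by
    constructor
    · intro t
      by_cases ht : t = s
      · subst ht
        simpa using hτ.1
      · rw [Pi.single_eq_of_ne ht]
        exact S.cone.zero_mem
    · rw [Finset.sum_eq_single s (fun t _ ht => by rw [Pi.single_eq_of_ne ht, map_zero])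
        (fun hn => absurd (Finset.mem_univ s) hn), Pi.single_eq_same, hτ.2]
  have h1 := hφ _ (Set.mem_image_of_mem _ hw)
  have h2 : φ (assemblageOfStrategies V g k (Pi.single s τ)) = ∑ x, ⨆ a, f x a τ := by
    rw [hdec]
    refine Finset.sum_congr rfl fun x _ => ?_
    rw [← hs x, Finset.sum_eq_single (s x)]
    · rw [assemblageOfStrategies_apply, Finset.sum_eq_single s]
      · simp
      · intro t _ ht
        simp [Pi.single_eq_of_ne ht]
      · exact fun hn => absurd (Finset.mem_univ s) hn
    · intro a _ ha
      rw [assemblageOfStrategies_apply, Finset.sum_eq_zero, map_zero]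
      intro t _
      by_cases ht : t = s
      · subst ht
        simp [ha.symm]
      · simp [Pi.single_eq_of_ne ht]
    · exact fun hn => absurd (Finset.mem_univ _) hn
  rw [hdec] at hu
  linarith

variable [MeasurableSpace V] [BorelSpace V]

theorem integrable_coe (S : GPTSystem V) (μ : ProbabilityMeasure S.stateSpace) :
    Integrable (fun ρ : S.stateSpace => (ρ : V)) (μ : Measure S.stateSpace) := by
  obtain ⟨C, hC⟩ := S.isCompact_stateSpace.isBounded.exists_norm_le
  exact Integrable.of_bound continuous_subtype_val.aestronglyMeasurable C
    (Filter.Eventually.of_forall fun x => hC _ x.2)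

theorem dual_integral_coe (S : GPTSystem V) (μ : ProbabilityMeasure S.stateSpace)
    (h : Module.Dual ℝ V) :
    h (∫ ρ, (ρ : V) ∂(μ : Measure S.stateSpace)) = ∫ ρ, h ρ ∂(μ : Measure S.stateSpace) :=
  (h.toContinuousLinearMap.integral_comp_comm (S.integrable_coe μ)).symm

/-- The inequality at `f` and at `-f` gives equality. One-sided bounds suffice, and they pass
through the convex order. -/
theorem integral_coe_eq_of_forall_dual_le (S : GPTSystem V) {μ : ProbabilityMeasure S.stateSpace}
    {v : V} (h : ∀ f : Module.Dual ℝ V, f v ≤ ∫ ρ, f ρ ∂(μ : Measure S.stateSpace)) :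
    ∫ ρ, (ρ : V) ∂(μ : Measure S.stateSpace) = v := by
  refine (Module.forall_dual_apply_eq_zero_iff ℝ _).1 (fun f => ?_) |> sub_eq_zero.1
  rw [map_sub, sub_eq_zero]
  refine le_antisymm ?_ ?_
  · have := h (-f)
    rw [← S.dual_integral_coe] at this
    simpa using this
  · rw [S.dual_integral_coe]
    exact h f

/-- The finitely supported measure with weights `q` at the states `τ`. -/
theorem exists_probabilityMeasure_integral_eq_sum (S : GPTSystem V) {n : ℕ} (q : Fin n → ℝ)
    (hq : ∀ l, 0 ≤ q l) (hq1 : ∑ l, q l = 1) (τ : Fin n → V) (hτ : ∀ l, τ l ∈ S.stateSpace) :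
    ∃ μ : ProbabilityMeasure S.stateSpace, ∀ φ : V → ℝ, Continuous φ →
      ∫ ρ, φ ρ ∂(μ : Measure S.stateSpace) = ∑ l, q l * φ (τ l) := by
  have hp : IsProbabilityMeasure
      (∑ l, ENNReal.ofReal (q l) • Measure.dirac (⟨τ l, hτ l⟩ : S.stateSpace)) := by
    constructor
    simp [Measure.finsetSum_apply, ← ENNReal.ofReal_sum_of_nonneg fun l _ => hq l, hq1]
  refine ⟨⟨_, hp⟩, fun φ hφ => ?_⟩
  have hm : StronglyMeasurable fun ρ : S.stateSpace => φ ρ :=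
    (hφ.comp continuous_subtype_val).stronglyMeasurable
  change ∫ ρ, φ ρ ∂(∑ l, ENNReal.ofReal (q l) • Measure.dirac (⟨τ l, hτ l⟩ : S.stateSpace)) = _
  rw [integral_finsetSum_measure]
  · refine Finset.sum_congr rfl fun l _ => ?_
    rw [integral_smul_measure, integral_dirac' _ _ hm, ENNReal.toReal_ofReal (hq l), smul_eq_mul]
  · intro l _
    exact (integrable_dirac' hm (by simp)).smul_measure (by simp)

end Single

/-! ### Bipartite states and steering measures -/

section Bipartite

variable {VA VB : Type*}
  [NormedAddCommGroup VA] [NormedSpace ℝ VA] [FiniteDimensional ℝ VA]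
  [NormedAddCommGroup VB] [NormedSpace ℝ VB] [FiniteDimensional ℝ VB]

theorem steeringMap_sum {ι : Type*} (s : Finset ι) (σ : VA ⊗[ℝ] VB) (f : ι → Module.Dual ℝ VA) :
    steeringMap σ (∑ a ∈ s, f a) = ∑ a ∈ s, steeringMap σ (f a) := by
  refine (Module.forall_dual_apply_eq_zero_iff ℝ _).1 (fun h => ?_) |> sub_eq_zero.1
  have hf := apply_steeringMap σ (∑ a ∈ s, f a) h
  rw [TensorProduct.sum_tmul, map_sum, LinearMap.sum_apply] at hf
  rw [map_sub, map_sum, sub_eq_zero]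
  exact hf.trans (Finset.sum_congr rfl fun a _ => (apply_steeringMap σ (f a) h).symm)

theorem steeringMap_unit_mem_stateSpace {A : GPTSystem VA} {B : GPTSystem VB} {σ : VA ⊗[ℝ] VB}
    (hσ : σ ∈ maxStateSpace A B) : steeringMap σ A.unit ∈ B.stateSpace := by
  refine ⟨B.mem_cone_of_forall_dual fun f hf => ?_, by rw [apply_steeringMap]; exact hσ.2⟩
  obtain ⟨α, hα, -, h2⟩ := B.orderUnit f
  -- Positivity of `σ` is known on effects only, so `f` is rescaled by its order unit bound.
  have heff : α⁻¹ • f ∈ B.effects := by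
    intro v hv
    have h3 := h2 v hv
    simp only [LinearMap.sub_apply, LinearMap.smul_apply, smul_eq_mul] at h3 ⊢
    refine ⟨mul_nonneg (inv_nonneg.2 hα.le) (hf v hv), ?_⟩
    rw [inv_mul_le_iff₀ hα]
    linarith
  have h4 := hσ.1 A.unit (fun v hv => ⟨A.unit_nonneg hv, le_rfl⟩) _ heff
  rw [← apply_steeringMap, LinearMap.smul_apply, smul_eq_mul] at h4
  exact nonneg_of_mul_nonneg_right h4 (inv_pos.2 hα)

/-- Without outcomes the unit would be an empty sum, against normalization of `σ`. -/
theorem Measurement.nonempty_fin {A : GPTSystem VA} {B : GPTSystem VB} {σ : VA ⊗[ℝ] VB}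
    (hσ : σ ∈ maxStateSpace A B) {k : ℕ} (f : A.Measurement k) : Nonempty (Fin k) := by
  by_contra hk
  rw [not_nonempty_iff] at hk
  have h0 : A.unit = 0 := by rw [← f.sum_effect, Finset.univ_eq_empty, Finset.sum_empty]
  have := hσ.2
  simp [h0] at this

variable [MeasurableSpace VB] [BorelSpace VB]

theorem unsteerable_of_steering_inequalities {A : GPTSystem VA} {B : GPTSystem VB} {k : ℕ}
    {F : Set (A.Measurement k)} {σ : VA ⊗[ℝ] VB} (hσ : σ ∈ maxStateSpace A B)
    (μ : ProbabilityMeasure B.stateSpace)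
    (hμ : ∀ f ∈ F, ∀ g : Fin k → Module.Dual ℝ VB, ∑ a, g a (steeringMap σ (f.effect a)) ≤
      ∫ ρ, (⨆ a, g a (ρ : VB)) ∂(μ : Measure B.stateSpace)) :
    Unsteerable A B F σ := by
  intro g f hf
  refine B.admitsLHS_of_forall_dual (fun x => (f x).nonempty_fin hσ) _ fun h => ?_
  have hint : ∀ x, Integrable (fun ρ : B.stateSpace => ⨆ a, h x a (ρ : VB))
      (μ : Measure B.stateSpace) := fun x =>
    integrable_of_measurable_of_continuous B.isCompact_stateSpace μ (continuous_iSup_dual (h x))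
      measurable_id
  obtain ⟨τ, hτ⟩ := exists_integral_le (μ := (μ : Measure B.stateSpace))
    (f := fun ρ : B.stateSpace => ∑ x, ⨆ a, h x a (ρ : VB))
    (integrable_finsetSum _ fun x _ => hint x)
  rw [integral_finsetSum _ fun x _ => hint x] at hτ
  exact ⟨τ, τ.2, (Finset.sum_le_sum fun x _ => hμ _ (hf x) _).trans hτ⟩

/-- The probability measures on the state space of `B` that satisfy the steering inequalities of
the measurement `f`. -/
def steeringMeasures (A : GPTSystem VA) (B : GPTSystem VB) {k : ℕ} (σ : VA ⊗[ℝ] VB)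
    (f : A.Measurement k) : Set (ProbabilityMeasure B.stateSpace) :=
  {μ | ∀ g : Fin k → Module.Dual ℝ VB, ∑ a, g a (steeringMap σ (f.effect a)) ≤
    ∫ ρ, (⨆ a, g a (ρ : VB)) ∂(μ : Measure B.stateSpace)}

theorem isClosed_steeringMeasures (A : GPTSystem VA) (B : GPTSystem VB) {k : ℕ}
    (σ : VA ⊗[ℝ] VB) (f : A.Measurement k) : IsClosed (steeringMeasures A B σ f) := by
  simp only [steeringMeasures, Set.ofPred_forall]
  exact isClosed_iInter fun g => isClosed_le continuous_const
    (continuous_integral_probabilityMeasure B.isCompact_stateSpace (continuous_iSup_dual g))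

omit [BorelSpace VB] in
theorem mem_steeringMeasures_of_model {A : GPTSystem VA} {B : GPTSystem VB} {k n : ℕ}
    {σ : VA ⊗[ℝ] VB} {f : A.Measurement k} {μ : ProbabilityMeasure B.stateSpace} {q : Fin n → ℝ}
    {p : Fin k → Fin n → ℝ} {τ : Fin n → VB} (hq : ∀ l, 0 ≤ q l) (hp : ∀ a l, 0 ≤ p a l)
    (hp1 : ∀ l, ∑ a, p a l = 1)
    (hμ : ∀ φ : VB → ℝ, Continuous φ →
      ∫ ρ, φ ρ ∂(μ : Measure B.stateSpace) = ∑ l, q l * φ (τ l))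
    (h : ∀ a, steeringMap σ (f.effect a) = ∑ l, (q l * p a l) • τ l) :
    μ ∈ steeringMeasures A B σ f := by
  intro g
  rw [hμ _ (continuous_iSup_dual g)]
  calc ∑ a, g a (steeringMap σ (f.effect a))
      = ∑ a, ∑ l, q l * (p a l * g a (τ l)) := by
        refine Finset.sum_congr rfl fun a _ => ?_
        simp only [h, map_sum, map_smul, smul_eq_mul, mul_assoc]
    _ = ∑ l, q l * ∑ a, p a l * g a (τ l) := by
        rw [Finset.sum_comm]
        simp only [Finset.mul_sum]
    _ ≤ ∑ l, q l * ⨆ a, g a (τ l) := by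
        refine Finset.sum_le_sum fun l _ => mul_le_mul_of_nonneg_left ?_ (hq l)
        calc ∑ a, p a l * g a (τ l) ≤ ∑ a, p a l * ⨆ a, g a (τ l) :=
              Finset.sum_le_sum fun a _ =>
                mul_le_mul_of_nonneg_left (dual_le_iSup g _ a) (hp a l)
          _ = ⨆ a, g a (τ l) := by rw [← Finset.sum_mul, hp1, one_mul]

/-- Constant families `g_a = h` turn the maximum into `h`, so the inequalities already fix the
barycenter. -/
theorem integral_coe_of_mem_steeringMeasures {A : GPTSystem VA} {B : GPTSystem VB} {k : ℕ}
    {σ : VA ⊗[ℝ] VB} {f : A.Measurement k} [Nonempty (Fin k)]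
    {μ : ProbabilityMeasure B.stateSpace} (hμ : μ ∈ steeringMeasures A B σ f) :
    ∫ ρ, (ρ : VB) ∂(μ : Measure B.stateSpace) = steeringMap σ A.unit := by
  refine B.integral_coe_eq_of_forall_dual_le fun h => ?_
  have := hμ fun _ => h
  simpa only [ciSup_const, ← map_sum, ← steeringMap_sum, f.sum_effect] using this

theorem Unsteerable.exists_mem_steeringMeasures {A : GPTSystem VA} {B : GPTSystem VB} {k : ℕ}
    {F : Set (A.Measurement k)} {σ : VA ⊗[ℝ] VB} (hσ : σ ∈ maxStateSpace A B)
    (h : Unsteerable A B F σ) :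
    ∃ μ : ProbabilityMeasure B.stateSpace,
      (∀ v : Module.Dual ℝ VB, v (steeringMap σ A.unit) ≤ ∫ ρ, v ρ ∂(μ : Measure B.stateSpace)) ∧
      ∀ f ∈ F, μ ∈ steeringMeasures A B σ f := by
  have : CompactSpace B.stateSpace := isCompact_iff_compactSpace.1 B.isCompact_stateSpace
  -- With `F` empty nothing constrains the barycenter, so the point mass at `σ_B` is used.
  rcases F.eq_empty_or_nonempty with rfl | ⟨f₀, hf₀⟩
  · obtain ⟨μ, hμ⟩ := B.exists_probabilityMeasure_integral_eq_sum (n := 1) (fun _ => 1)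
      (fun _ => zero_le_one) (by simp) (fun _ => steeringMap σ A.unit)
      (fun _ => steeringMap_unit_mem_stateSpace hσ)
    refine ⟨μ, fun v => ?_, fun f hf => absurd hf (Set.notMem_empty f)⟩
    rw [hμ _ v.continuous_of_finiteDimensional]
    simp
  have := f₀.nonempty_fin hσ
  obtain ⟨μ, -, hμ⟩ := isCompact_univ.inter_iInter_nonempty
    (fun f : F => steeringMeasures A B σ f.1) (fun f => isClosed_steeringMeasures A B σ f.1)
    (fun u => by
      let e := u.equivFin.symm
      obtain ⟨n, q, p, τ, hq, hq1, hp, hp1, hτ, hmod⟩ :=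
        h u.card (fun x => (e x).1.1) (fun x => (e x).1.2)
      obtain ⟨μ, hμ⟩ := B.exists_probabilityMeasure_integral_eq_sum q hq hq1 τ hτ
      refine ⟨μ, Set.mem_univ _, Set.mem_iInter₂.2 fun f hf => ?_⟩
      obtain ⟨x, hx⟩ := e.surjective ⟨f, hf⟩
      have := mem_steeringMeasures_of_model (A := A) (σ := σ) hq (hp x) (hp1 x) hμ (hmod x)
      rwa [hx] at this)
  rw [Set.mem_iInter] at hμ
  refine ⟨μ, fun v => ?_, fun f hf => hμ ⟨f, hf⟩⟩
  rw [← B.dual_integral_coe, integral_coe_of_mem_steeringMeasures (hμ ⟨f₀, hf₀⟩)]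

end Bipartite

end GPTSystem

/-! ### The equivalence -/

theorem mainTheorem4 {VA VB : Type*}
    [NormedAddCommGroup VA] [NormedSpace ℝ VA] [FiniteDimensional ℝ VA]
    [NormedAddCommGroup VB] [NormedSpace ℝ VB] [FiniteDimensional ℝ VB]
    [MeasurableSpace VB] [BorelSpace VB]
    (A : GPTSystem VA) (B : GPTSystem VB) {k : ℕ} (F : Set (A.Measurement k))
    (σ : VA ⊗[ℝ] VB) (hσ : σ ∈ GPTSystem.maxStateSpace A B) :
    GPTSystem.Unsteerable A B F σ ↔
      ∃ μ ∈ B.boundaryMeasures (GPTSystem.steeringMap σ A.unit),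
        ∀ f ∈ F, ∀ g : Fin k → Module.Dual ℝ VB,
          ∑ a, g a (GPTSystem.steeringMap σ (f.effect a)) ≤
            ∫ ρ, (⨆ a, g a (ρ : VB)) ∂(μ : Measure B.stateSpace) := by
  constructor
  · intro h
    obtain ⟨μ, hbar, hμ⟩ := h.exists_mem_steeringMeasures hσ
    obtain ⟨ν, hν, hdom⟩ :=
      exists_extremal_dominating B.isCompact_stateSpace B.convex_stateSpace μ
    refine ⟨ν, ⟨hν, B.integral_coe_eq_of_forall_dual_le fun v => (hbar v).trans ?_⟩,
      fun f hf g => (hμ f hf g).trans ?_⟩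
    · exact hdom _ v.continuous_of_finiteDimensional (v.convexOn B.convex_stateSpace)
    · exact hdom _ (continuous_iSup_dual g) (convexOn_iSup_dual g B.convex_stateSpace)
  · rintro ⟨μ, -, hμ⟩
    exact GPTSystem.unsteerable_of_steering_inequalities hσ μ hμ
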